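/- A simplicial complex $K$ with non-empty vertex set $V_K$ is called $r$-ample if for every subset $U\subseteq V_K$ with at most $r$ elements and every (possibly empty) subcomplex $L\leqslant K$ with vertex set $V_L\subseteq U$ there is a vertex $v\in V_K$ such that the simplices of the link $\mathrm{lk}_K(v)$ that are contained in $U$ are exactly the simplices of $L$. A topological space $X$ is $n$-connected if it is non-empty and, for every $0\le k\le n$, each continuous map $S^k\to X$ is null-homotopic; a simplicial complex is $n$-connected (simply connected) if its geometric realization, with the weak topology, is. Theorem. For every integer $n\ge 0$ there exists an infinite simplicial complex $K$ which is $(2n+1)$-ample and which is not $n$-connected. In particular, $3$-ampleness does not imply simple connectivity: there exists a $3$-ample simplicial complex which is not simply connected. -/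

import Mathlib

namespace AbstractSimplicialComplex

variable {V : Type*}

/-- The link of the vertex `v`: the simplices `σ` with `v ∉ σ` and `σ ∪ {v}` a simplex of `K`. -/
def link (K : AbstractSimplicialComplex V) (v : V) : PreAbstractSimplicialComplex V where
  faces := {σ | σ.Nonempty ∧ ∃ h : v ∉ σ, Finset.cons v σ h ∈ K.faces}
  isRelLowerSet_faces := by
    rintro σ ⟨hσ, hv, hK⟩
    refine ⟨hσ, fun τ hτσ hτ => ⟨hτ, fun h => hv (hτσ h), ?_⟩⟩
    exact (K.isRelLowerSet_faces hK).2 (Finset.cons_subset_cons.2 hτσ) (Finset.cons_nonempty _)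

/-- A (non-empty) simplicial complex `K` with vertex set `V` is `r`-ample if for every set `U` of
at most `r` vertices and every (possibly empty) subcomplex `L` of `K` whose vertices lie in `U`,
there is a vertex `v` such that the simplices of the link of `v` contained in `U` are exactly
those of `L`. -/
def IsAmple (K : AbstractSimplicialComplex V) (r : ℕ) : Prop :=
  Nonempty V ∧
    ∀ U : Finset V, U.card ≤ r →
      ∀ L : PreAbstractSimplicialComplex V, L ≤ K.toPreAbstractSimplicialComplex →
        (∀ u : V, {u} ∈ L.faces → u ∈ U) →
          ∃ v : V, ∀ σ : Finset V, (σ ∈ (K.link v).faces ∧ σ ⊆ U) ↔ σ ∈ L.faces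

/-- The closed geometric simplex spanned by `s`, in barycentric coordinates indexed by `V`. As a
subspace of the product `V → ℝ` it carries the usual topology of a simplex. -/
def closedSimplex (s : Finset V) : Set (V → ℝ) :=
  {x | (∀ v, 0 ≤ x v) ∧ (∀ v, v ∉ s → x v = 0) ∧ ∑ v ∈ s, x v = 1}

/-- The geometric realization `|K|`: the union of the closed simplices spanned by the faces. -/
def Realization (K : AbstractSimplicialComplex V) : Type _ :=
  {x : V → ℝ // ∃ s ∈ K.faces, x ∈ closedSimplex s}

/-- The inclusion of the closed simplex of a face into the geometric realization. -/
def simplexInclusion (K : AbstractSimplicialComplex V) (s : K.faces) :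
    closedSimplex (s : Finset V) → K.Realization :=
  fun x => ⟨x.1, s.1, s.2, x.2⟩

/-- The weak (coherent) topology on `|K|`: a set is open (closed) if and only if its preimage in
every closed simplex is open (closed). -/
instance instTopologicalSpaceRealization (K : AbstractSimplicialComplex V) :
    TopologicalSpace K.Realization :=
  ⨆ s : K.faces, TopologicalSpace.coinduced (K.simplexInclusion s) inferInstance

end AbstractSimplicialComplex

/-- A space `X` is `n`-connected if it is non-empty and for every `0 ≤ k ≤ n` each continuous map
from the unit sphere of `ℝ ^ (k + 1)` to `X` is null-homotopic. -/
def IsNConnected (n : ℕ) (X : Type*) [TopologicalSpace X] : Prop :=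
  Nonempty X ∧
    ∀ k : ℕ, k ≤ n →
      ∀ f : C(Metric.sphere (0 : EuclideanSpace ℝ (Fin (k + 1))) 1, X), f.Nullhomotopic

/-! The construction makes K ample while keeping a retraction onto Sⁿ. Each vertex carries a label
among the 2n+2 vertices ±eᵢ of the cross-polytope in ℝⁿ⁺¹ and a level in ℕ. No face contains
antipodal labels, so the labelling extends affinely to a nowhere zero map |K| → ℝⁿ⁺¹, hence to a map
|K| → Sⁿ. Level 0 contains the whole boundary of the cross-polytope, on which this map restricts to
the radial homeomorphism. If K were n-connected, the identity of Sⁿ would be null-homotopic.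

Ampleness (`isAmple_levelComplex`): at most 2n+1 vertices miss some label p, so a vertex labelled −p
never conflicts with them. Placed at a high level m with `c m = L`, its link meets U exactly in L.

That Sⁿ is not contractible is proved analytically. For a C¹ retraction r, the integral over the
ball of the Jacobian of x + t(r(x) − x) is polynomial in t and equals the volume for small t > 0,
hence also at t = 1, where the Jacobian is zero. Mollification passes to continuous maps. Simple
connectivity is refuted for n = 1 by lifting paths along ℝ → S¹. -/

/-! ### No C¹ retraction onto a sphere -/

open MeasureTheory Metric Polynomial in
/-- The determinant of `1 + t A` is a polynomial in `t`, of degree at most the dimension. -/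
theorem exists_polynomial_det_id_add_smul {E : Type*} [NormedAddCommGroup E] [NormedSpace ℝ E]
    [FiniteDimensional ℝ E] (A : E →L[ℝ] E) :
    ∃ p : ℝ[X], p.natDegree ≤ Module.finrank ℝ E ∧
      ∀ t : ℝ, p.eval t = (ContinuousLinearMap.id ℝ E + t • A).det := by
  classical
  let b := Module.finBasis ℝ E
  let M := LinearMap.toMatrix b b (A : E →ₗ[ℝ] E)
  refine ⟨((X : ℝ[X]) • M.map C + (1 : Matrix _ _ ℝ).map C).det, ?_, fun t => ?_⟩
  · simpa using natDegree_det_X_add_C_le M 1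
  · have h : (ContinuousLinearMap.id ℝ E + t • A).det =
        (LinearMap.toMatrix b b ((ContinuousLinearMap.id ℝ E + t • A : E →L[ℝ] E) : E →ₗ[ℝ] E)).det :=
      (LinearMap.det_toMatrix b _).symm
    rw [h, ← coe_evalRingHom, RingHom.map_det]
    congr 1
    have : (((ContinuousLinearMap.id ℝ E + t • A : E →L[ℝ] E)) : E →ₗ[ℝ] E) =
        LinearMap.id + t • (A : E →ₗ[ℝ] E) := rfl
    rw [this, (LinearMap.toMatrix b b).map_add, (LinearMap.toMatrix b b).map_smul,
      LinearMap.toMatrix_id]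
    ext i j
    by_cases hij : i = j <;> simp [M, hij] <;> ring

open Polynomial in
/-- The value at `1` of a polynomial of bounded degree is a fixed combination of its values at
finitely many arbitrarily small nodes. -/
theorem exists_eval_one_eq_sum (d : ℕ) {δ : ℝ} (hδ : 0 < δ) :
    ∃ (v w : ℕ → ℝ), (∀ i ∈ Finset.range (d + 1), 0 < v i ∧ v i < δ) ∧
      ∀ p : ℝ[X], p.natDegree ≤ d →
        p.eval 1 = ∑ i ∈ Finset.range (d + 1), w i * p.eval (v i) := by
  -- The shift by 2 keeps the node at `i = 0` strictly below `δ`.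
  let v : ℕ → ℝ := fun i => δ / (i + 2)
  refine ⟨v, fun i => (Lagrange.basis (Finset.range (d + 1)) v i).eval 1, fun i _ => ⟨?_, ?_⟩,
    fun p hp => ?_⟩
  · positivity
  · have : (0 : ℝ) ≤ i := i.cast_nonneg
    exact div_lt_self hδ (by linarith)
  · have hv : Set.InjOn v (Finset.range (d + 1)) := by
      intro i _ j _ hij
      have h1 : (i : ℝ) + 2 ≠ 0 := by positivity
      have h2 : (j : ℝ) + 2 ≠ 0 := by positivity
      have h : δ / ((i : ℝ) + 2) = δ / (j + 2) := hij
      rw [div_eq_div_iff h1 h2] at h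
      have := mul_left_cancel₀ hδ.ne' h
      exact_mod_cast (add_right_cancel this).symm
    have hdeg : p.degree < ((Finset.range (d + 1)).card : WithBot ℕ) := by
      rw [Finset.card_range]
      exact lt_of_le_of_lt degree_le_natDegree (by exact_mod_cast Nat.lt_succ_of_le hp)
    conv_lhs => rw [Lagrange.eq_interpolate hv hdeg]
    simp [Lagrange.interpolate_apply, eval_finsetSum, mul_comm]

/-- A perturbation of the identity with small Lipschitz constant is bijective. -/
theorem bijective_add_smul_of_lipschitzWith {E : Type*} [NormedAddCommGroup E] [NormedSpace ℝ E]
    [CompleteSpace E] {k : E → E} {C : NNReal} (hk : LipschitzWith C k) {t : ℝ} (ht : 0 ≤ t)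
    (htC : t * C < 1) : Function.Bijective fun x => x + t • k x := by
  rcases subsingleton_or_nontrivial E with h | h
  · exact ⟨fun _ _ _ => Subsingleton.elim _ _, fun y => ⟨y, Subsingleton.elim _ _⟩⟩
  lift t to NNReal using ht
  have happ : ApproximatesLinearOn (fun x => x + (t : ℝ) • k x)
      ((ContinuousLinearEquiv.refl ℝ E : E ≃L[ℝ] E) : E →L[ℝ] E) Set.univ (t * C) := by
    intro x _ y _
    have h1 : x + (t : ℝ) • k x - (y + (t : ℝ) • k y) -
        ((ContinuousLinearEquiv.refl ℝ E : E ≃L[ℝ] E) : E →L[ℝ] E) (x - y) =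
        (t : ℝ) • (k x - k y) := by
      simp [smul_sub]; abel
    rw [h1, norm_smul, NNReal.coe_mul, mul_assoc, Real.norm_of_nonneg t.coe_nonneg]
    exact mul_le_mul_of_nonneg_left (by simpa [dist_eq_norm] using hk.dist_le_mul x y) t.2
  refine (happ.toHomeomorph _ (Or.inr ?_)).bijective
  have : ‖((ContinuousLinearEquiv.refl ℝ E).symm : E →L[ℝ] E)‖₊ = 1 := by
    ext; exact ContinuousLinearMap.norm_id
  rw [this, inv_one]
  exact_mod_cast htC

open Metric in
/-- A function that is Lipschitz on a closed ball and vanishes on its boundary sphere stays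
Lipschitz when it is cut off to zero outside the ball. -/
theorem LipschitzOnWith.lipschitzWith_indicator_closedBall {E F : Type*} [NormedAddCommGroup E]
    [NormedSpace ℝ E] [NormedAddCommGroup F] {k : E → F} {C : NNReal} {R : ℝ}
    (hk : LipschitzOnWith C k (closedBall 0 R)) (h0 : ∀ x, ‖x‖ = R → k x = 0) :
    LipschitzWith C ((closedBall (0 : E) R).indicator k) := by
  have key : ∀ x y : E, ‖x‖ ≤ R → R < ‖y‖ → ‖k x‖ ≤ C * ‖x - y‖ := by
    intro x y hx hy
    -- The segment from `x` to `y` crosses the sphere, where `k` vanishes, no further from `x` than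
    -- `y` is.
    obtain ⟨s, hs, hs'⟩ : ∃ s ∈ Set.Icc (0 : ℝ) 1, ‖x + s • (y - x)‖ = R := by
      have hc : ContinuousOn (fun s : ℝ => ‖x + s • (y - x)‖) (Set.Icc 0 1) := by fun_prop
      have := intermediate_value_Icc zero_le_one hc
      exact this ⟨by simpa using hx, by simpa using hy.le⟩
    have h1 := hk.norm_sub_le (by simpa using hx : x ∈ closedBall (0 : E) R)
      (by simpa using hs'.le : x + s • (y - x) ∈ closedBall (0 : E) R)
    rw [h0 _ hs', sub_zero] at h1
    refine h1.trans (mul_le_mul_of_nonneg_left ?_ C.2)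
    have h2 : x - (x + s • (y - x)) = s • (x - y) := by rw [smul_sub, smul_sub]; abel
    rw [h2, norm_smul, Real.norm_of_nonneg hs.1]
    exact mul_le_of_le_one_left (norm_nonneg _) hs.2
  refine LipschitzWith.of_dist_le_mul fun x y => ?_
  rw [dist_eq_norm, dist_eq_norm]
  by_cases hx : ‖x‖ ≤ R <;> by_cases hy : ‖y‖ ≤ R
  · rw [Set.indicator_of_mem (by simpa using hx), Set.indicator_of_mem (by simpa using hy)]
    exact hk.norm_sub_le (by simpa using hx) (by simpa using hy)
  · rw [Set.indicator_of_mem (by simpa using hx), Set.indicator_of_notMem (by simpa using hy),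
      sub_zero]
    exact key x y hx (not_le.1 hy)
  · rw [Set.indicator_of_notMem (by simpa using hx), Set.indicator_of_mem (by simpa using hy),
      zero_sub, norm_neg, norm_sub_rev]
    exact key y x hy (not_le.1 hx)
  · rw [Set.indicator_of_notMem (by simpa using hx), Set.indicator_of_notMem (by simpa using hy)]
    simpa using mul_nonneg C.coe_nonneg (norm_nonneg (x - y))

/-- The derivative of a map of constant non-zero norm is singular. -/
theorem HasFDerivAt.det_eq_zero_of_norm_eq {E : Type*} [NormedAddCommGroup E]
    [InnerProductSpace ℝ E] [FiniteDimensional ℝ E] {r : E → E} {r' : E →L[ℝ] E} {x : E} {R : ℝ}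
    (hr : HasFDerivAt r r' x) (hR : R ≠ 0) (hn : ∀ y, ‖r y‖ = R) : r'.det = 0 := by
  by_contra hdet
  have h1 := hr.norm_sq
  have h2 : HasFDerivAt (fun y => ‖r y‖ ^ 2) (0 : E →L[ℝ] ℝ) x := by
    simp only [hn]; exact hasFDerivAt_const _ _
  have h3 := h1.unique h2
  have hunit : IsUnit (LinearMap.det (r' : E →ₗ[ℝ] E)) := isUnit_iff_ne_zero.2 hdet
  -- Constant norm forces `r' v ⟂ r x` for all `v`; an invertible `r'` would hit `r x` itself, which
  -- is non-zero.
  obtain ⟨v, hv⟩ := (Module.End.isUnit_iff _).1 ((LinearMap.isUnit_iff_isUnit_det _).2 hunit) |>.2 (r x)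
  have hv' : r' v = r x := hv
  have h4 := congrArg (fun L : E →L[ℝ] ℝ => L v) h3
  simp [hv', hn, hR] at h4

open Metric MeasureTheory in
/-- There is no `C¹` map from a Euclidean space to a sphere of positive radius which restricts to
the identity on that sphere. -/
theorem no_smooth_retraction_sphere {E : Type*} [NormedAddCommGroup E]
    [InnerProductSpace ℝ E] [FiniteDimensional ℝ E] {r : E → E} {R : ℝ}
    (hr : ContDiff ℝ 1 r) (hR : 0 < R) (hn : ∀ y, ‖r y‖ = R) (hid : ∀ y, ‖y‖ = R → r y = y) :
    False := by
  borelize E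
  let B : Set E := ball 0 R
  let k : E → E := (closedBall (0 : E) R).indicator fun x => r x - x
  let A : E → E →L[ℝ] E := fun x => fderiv ℝ r x - ContinuousLinearMap.id ℝ E
  have hA : Continuous A := (hr.continuous_fderiv one_ne_zero).sub continuous_const
  have hderiv : ∀ x, HasFDerivAt (fun x => r x - x) (A x) x := fun x =>
    ((hr.differentiable one_ne_zero x).hasFDerivAt).sub (hasFDerivAt_id x)
  obtain ⟨C, hC⟩ : ∃ C : NNReal, ∀ x ∈ closedBall (0 : E) R, ‖A x‖₊ ≤ C := by
    obtain ⟨M, hM⟩ := (isCompact_closedBall (0 : E) R).exists_bound_of_continuousOn hA.continuousOn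
    exact ⟨M.toNNReal, fun x hx => by
      rw [← NNReal.coe_le_coe, coe_nnnorm]; exact (hM x hx).trans (Real.le_coe_toNNReal M)⟩
  have hlipOn : LipschitzOnWith C (fun x => r x - x) (closedBall 0 R) :=
    (convex_closedBall (0 : E) R).lipschitzOnWith_of_nnnorm_fderiv_le (𝕜 := ℝ)
      (fun x _ => (hderiv x).differentiableAt) (fun x hx => by rw [(hderiv x).fderiv]; exact hC x hx)
  have hlip : LipschitzWith C k :=
    hlipOn.lipschitzWith_indicator_closedBall fun x hx => by rw [hid x hx, sub_self]
  have hk0 : ∀ x, x ∉ B → k x = 0 := by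
    intro x hx
    have hx : R ≤ ‖x‖ := by simpa [B] using hx
    rcases hx.eq_or_lt with h | h
    · simp [k, h.symm, hid x h.symm]
    · exact Set.indicator_of_notMem (by simpa using h) _
  -- near the identity, the determinant is positive
  obtain ⟨ε, hε, hdet⟩ : ∃ ε > 0, ∀ T : E →L[ℝ] E, ‖T‖ < ε →
      0 < (ContinuousLinearMap.id ℝ E + T).det := by
    have hc : Continuous fun T : E →L[ℝ] E => (ContinuousLinearMap.id ℝ E + T).det :=
      ContinuousLinearMap.continuous_det.comp (continuous_const.add continuous_id)
    have hU : {T : E →L[ℝ] E | 0 < (ContinuousLinearMap.id ℝ E + T).det} ∈ nhds 0 := by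
      refine (isOpen_lt continuous_const hc).mem_nhds ?_
      have : LinearMap.det (LinearMap.id : E →ₗ[ℝ] E) = 1 := LinearMap.det_id
      simp only [Set.mem_ofPred_eq, add_zero]
      change 0 < LinearMap.det (LinearMap.id : E →ₗ[ℝ] E)
      rw [this]; exact one_pos
    obtain ⟨ε, hε, h⟩ := Metric.mem_nhds_iff.1 hU
    exact ⟨ε, hε, fun T hT => h (by simpa using hT)⟩
  -- For `0 < t < δ` both `t * C < 1` (bijectivity) and `‖t • A x‖ < ε` on the ball (positive
  -- determinant) hold; the `+ 1` covers `C = 0`.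
  let δ : ℝ := min 1 ε / (C + 1)
  have hC1 : (0 : ℝ) < C + 1 := by positivity
  have hδ : 0 < δ := by positivity
  have hcont : ∀ t : ℝ, Continuous fun x => (ContinuousLinearMap.id ℝ E + t • A x).det := fun t =>
    ContinuousLinearMap.continuous_det.comp (continuous_const.add (hA.const_smul t))
  have hint : ∀ t : ℝ,
      IntegrableOn (fun x => (ContinuousLinearMap.id ℝ E + t • A x).det) B volume := fun t =>
    ((hcont t).continuousOn.integrableOn_compact (isCompact_closedBall (0 : E) R)).mono_set
      ball_subset_closedBall
  have hvol : ∀ t : ℝ, 0 < t → t < δ →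
      ∫ x in B, (ContinuousLinearMap.id ℝ E + t • A x).det = volume.real B := by
    intro t ht htδ
    have h1 : t * (C + 1) < min 1 ε := (lt_div_iff₀ hC1).1 htδ
    have htC : t * C < min 1 ε := lt_of_le_of_lt (by nlinarith) h1
    have hbij := bijective_add_smul_of_lipschitzWith hlip ht.le (htC.trans_le (min_le_left _ _))
    set f : E → E := fun x => x + t • k x with hf
    have hfix : ∀ x, x ∉ B → f x = x := fun x hx => by simp [hf, hk0 x hx]
    -- A bijection fixing the complement of `B` pointwise preserves `B`.
    have himage : f '' B = B := by
      have : f '' Bᶜ = Bᶜ := by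
        exact (Set.image_congr (g := id) hfix).trans (Set.image_id _)
      rw [← compl_compl B, Set.image_compl_eq hbij, this]
    have hfd : ∀ x ∈ B, HasFDerivWithinAt f (ContinuousLinearMap.id ℝ E + t • A x) B x := by
      intro x hx
      have : HasFDerivAt f (ContinuousLinearMap.id ℝ E + t • A x) x := by
        have h2 := (hasFDerivAt_id x).add ((hderiv x).const_smul t)
        refine h2.congr_of_eventuallyEq ?_
        filter_upwards [isOpen_ball.mem_nhds hx] with y hy
        simp [hf, k, Set.indicator_of_mem (ball_subset_closedBall hy)]
      exact this.hasFDerivWithinAt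
    have hcv := integral_image_eq_integral_abs_det_fderiv_smul volume measurableSet_ball hfd
      hbij.1.injOn (fun _ => (1 : ℝ))
    rw [himage] at hcv
    have : ∫ x in B, (1 : ℝ) = volume.real B := by simp
    rw [← this, hcv]
    refine setIntegral_congr_fun measurableSet_ball fun x hx => ?_
    have hpos : 0 < (ContinuousLinearMap.id ℝ E + t • A x).det := by
      refine hdet _ (lt_of_le_of_lt ?_ (htC.trans_le (min_le_right _ _)))
      rw [norm_smul, Real.norm_of_nonneg ht.le]
      exact mul_le_mul_of_nonneg_left (by exact_mod_cast hC x (ball_subset_closedBall hx)) ht.le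
    simp [abs_of_pos hpos]
  -- Nodes and weights do not depend on `x`, so interpolation commutes with integration over `B`.
  obtain ⟨v, w, hv, hw⟩ := exists_eval_one_eq_sum (Module.finrank ℝ E) hδ
  have hw1 : ∑ i ∈ Finset.range (Module.finrank ℝ E + 1), w i = 1 := by
    simpa using (hw 1 (by simp)).symm
  have hsum : ∀ x, (fderiv ℝ r x).det = ∑ i ∈ Finset.range (Module.finrank ℝ E + 1),
      w i * (ContinuousLinearMap.id ℝ E + v i • A x).det := by
    intro x
    obtain ⟨p, hp, hpe⟩ := exists_polynomial_det_id_add_smul (A x)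
    have := hw p hp
    simp only [hpe, one_smul] at this
    rw [← this]
    simp [A]
  have htotal : ∫ x in B, (fderiv ℝ r x).det = volume.real B := by
    simp only [hsum]
    rw [integral_finsetSum _ fun i _ => (hint (v i)).const_mul (w i)]
    simp only [integral_const_mul]
    rw [Finset.sum_congr rfl fun i hi => by rw [hvol (v i) (hv i hi).1 (hv i hi).2],
      ← Finset.sum_mul, hw1, one_mul]
  have hzero : ∀ x, (fderiv ℝ r x).det = 0 := fun x =>
    ((hr.differentiable one_ne_zero x).hasFDerivAt).det_eq_zero_of_norm_eq hR.ne' hn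
  simp only [hzero, integral_zero] at htotal
  have : 0 < volume.real B := by
    refine ENNReal.toReal_pos (measure_ball_pos volume 0 hR).ne' measure_ball_lt_top.ne
  linarith

/-! ### Non-contractibility of spheres -/

open MeasureTheory Metric in
/-- A nowhere vanishing continuous self-map of a Euclidean space cannot be the identity outside
the unit ball. -/
theorem exists_eq_zero_of_eq_self_of_one_le_norm {E : Type*} [NormedAddCommGroup E]
    [InnerProductSpace ℝ E] [FiniteDimensional ℝ E] {G : E → E} (hG : Continuous G)
    (hid : ∀ x, 1 ≤ ‖x‖ → G x = x) : ∃ x, G x = 0 := by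
  by_contra! hne
  borelize E
  obtain ⟨δ, hδ, hGδ⟩ : ∃ δ > 0, ∀ x, δ ≤ ‖G x‖ := by
    obtain ⟨x₀, -, hx₀⟩ := (isCompact_closedBall (0 : E) 1).exists_isMinOn
      ⟨0, by simp⟩ hG.norm.continuousOn
    refine ⟨min 1 ‖G x₀‖, lt_min one_pos (norm_pos_iff.2 (hne x₀)), fun x => ?_⟩
    rcases le_total ‖x‖ 1 with h | h
    · exact (min_le_right _ _).trans (hx₀ (by simpa using h : x ∈ closedBall (0 : E) 1))
    · rw [hid x h]; exact (min_le_left _ _).trans h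
  let h : E → E := fun x => G x - x
  have hh : Continuous h := hG.sub continuous_id
  have hh0 : ∀ x, 1 ≤ ‖x‖ → h x = 0 := fun x hx => by simp [h, hid x hx]
  have hsupp : HasCompactSupport h := by
    refine HasCompactSupport.intro (isCompact_closedBall (0 : E) 1) fun x hx => hh0 x ?_
    exact le_of_lt (by simpa using hx)
  obtain ⟨ε, hε, hunif⟩ :=
    Metric.uniformContinuous_iff.1 (hsupp.uniformContinuous_of_continuous hh) (δ / 2) (by positivity)
  have hε' : 0 < min ε 1 := lt_min hε one_pos
  -- Radius at most `ε` keeps the mollification within `δ / 2` of `h`; radius at most 1 makes it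
  -- vanish for `‖x‖ ≥ 2`, whence the sphere of radius 2 below.
  let φ : ContDiffBump (0 : E) := ⟨min ε 1 / 2, min ε 1, by positivity, by linarith⟩
  let g : E → E := convolution (φ.normed volume) h (ContinuousLinearMap.lsmul ℝ ℝ) volume
  have hg : ContDiff ℝ 1 g := φ.hasCompactSupport_normed.contDiff_convolution_left _
    (n := 1) φ.contDiff_normed hh.locallyIntegrable
  have hgh : ∀ x, dist (g x) (h x) ≤ δ / 2 := fun x =>
    φ.dist_normed_convolution_le hh.aestronglyMeasurable fun y hy =>
      (hunif ((mem_ball.1 hy).trans_le (min_le_left _ _))).le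
  have hg0 : ∀ x, 2 ≤ ‖x‖ → g x = 0 := by
    intro x hx
    have hx0 : h x = 0 := hh0 x (by linarith)
    rw [← hx0]
    refine φ.normed_convolution_eq_right fun y hy => ?_
    rw [hx0]
    refine hh0 y ?_
    have h1 : ‖x - y‖ < 1 := by
      rw [← dist_eq_norm, dist_comm]; exact (mem_ball.1 hy).trans_le (min_le_right _ _)
    linarith [norm_sub_norm_le x y]
  let F : E → E := fun x => x + g x
  have hF : ContDiff ℝ 1 F := contDiff_id.add hg
  have hFne : ∀ x, F x ≠ 0 := by
    intro x hx
    have h1 : F x = G x + (g x - h x) := by simp only [F, h]; abel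
    have h2 : ‖G x‖ ≤ δ / 2 := by
      have : G x = -(g x - h x) := by rw [← add_eq_zero_iff_eq_neg, ← h1, hx]
      rw [this, norm_neg, ← dist_eq_norm]; exact hgh x
    linarith [hGδ x]
  refine no_smooth_retraction_sphere (r := fun x => (2 * ‖F x‖⁻¹) • F x) (R := 2)
    ((contDiff_const.mul ((hF.norm ℝ hFne).inv fun x => norm_ne_zero_iff.2 (hFne x))).smul hF)
    two_pos (fun y => ?_) fun y hy => ?_
  · have := norm_ne_zero_iff.2 (hFne y)
    rw [norm_smul, norm_mul, norm_inv, norm_norm, mul_assoc, inv_mul_cancel₀ this]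
    norm_num
  · have : F y = y := by simp [F, hg0 y hy.ge]
    simp [this, hy]

open Metric in
/-- The unit sphere of a Euclidean space is not contractible. -/
theorem not_nullhomotopic_id_sphere (E : Type*) [NormedAddCommGroup E]
    [InnerProductSpace ℝ E] [FiniteDimensional ℝ E] :
    ¬ (ContinuousMap.id (sphere (0 : E) 1)).Nullhomotopic := by
  rintro ⟨p, ⟨H⟩⟩
  -- Homotopy time as a function of the norm: 1 up to radius 1/2, where the value is the constant
  -- `p`, and 0 from radius 1 on, where the direction is unchanged.
  let σ : ℝ → unitInterval := fun s => Set.projIcc 0 1 zero_le_one (2 - 2 * s)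
  have hσ : Continuous σ := continuous_projIcc.comp (by fun_prop)
  let N : {x : E // x ≠ 0} → sphere (0 : E) 1 := fun x => ⟨‖x.1‖⁻¹ • x.1, by
    simp [norm_smul, inv_mul_cancel₀ (norm_ne_zero_iff.2 x.2)]⟩
  have hN : Continuous N := by
    refine Continuous.subtype_mk (Continuous.smul (Continuous.inv₀ (by fun_prop) ?_) (by fun_prop)) _
    exact fun x => norm_ne_zero_iff.2 x.2
  let g : {x : E // x ≠ 0} → E := fun x => max 1 ‖x.1‖ • (H (σ ‖x.1‖, N x) : E)
  have hg : Continuous g := by fun_prop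
  classical
  let G : E → E := fun x => if hx : x = 0 then p else g ⟨x, hx⟩
  have hsmall : ∀ x : E, ‖x‖ < 1 / 2 → G x = p := by
    intro x hx
    by_cases h : x = 0
    · simp [G, h]
    · have h1 : σ ‖x‖ = 1 := Set.projIcc_of_right_le _ (by linarith)
      have h2 : max 1 ‖x‖ = 1 := max_eq_left (by linarith)
      simp [G, h, g, h1, h2]
  have hG : Continuous G := by
    rw [continuous_iff_continuousAt]
    intro x
    by_cases h : x = 0
    · refine (continuousAt_const (y := (p : E))).congr ?_
      filter_upwards [ball_mem_nhds x (by norm_num : (0 : ℝ) < 1 / 2)] with y hy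
      exact (hsmall y (by simpa [h] using hy)).symm
    · have hr : ({x : E | x ≠ 0}).domRestrict G = g := by
        ext y; simp [G, Set.domRestrict, dif_neg y.2]
      have hc : ContinuousOn G {x : E | x ≠ 0} := by
        rw [continuousOn_iff_continuous_domRestrict, hr]; exact hg
      exact hc.continuousAt (isOpen_ne.mem_nhds h)
  obtain ⟨x, hx⟩ := exists_eq_zero_of_eq_self_of_one_le_norm hG fun x hx => by
    have h0 : x ≠ 0 := norm_pos_iff.1 (by linarith)
    have h1 : σ ‖x‖ = 0 := Set.projIcc_of_le_left _ (by linarith)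
    have h2 : max 1 ‖x‖ = ‖x‖ := max_eq_right hx
    simp [G, h0, g, h1, h2, N]
  by_cases h : x = 0
  · simp only [G, h, dite_true] at hx
    have := p.2
    rw [hx] at this
    simp at this
  · simp only [G, h, dite_false, g, smul_eq_zero] at hx
    rcases hx with hx | hx
    · linarith [le_max_left 1 ‖x‖]
    · have := (H (σ ‖x‖, N ⟨x, h⟩)).2
      rw [hx] at this
      simp at this

/-! ### Retracts onto the circle -/

/-- A space through which the identity of the circle factors is not simply connected. -/
theorem not_simplyConnectedSpace_of_circle_retract {X : Type*} [TopologicalSpace X]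
    (f : C(Circle, X)) (g : C(X, Circle)) (hgf : g.comp f = ContinuousMap.id Circle) :
    ¬ SimplyConnectedSpace X := by
  intro _
  let e : C(unitInterval, ℝ) := ⟨fun t => 2 * Real.pi * t, by fun_prop⟩
  let γ : Path (f (Circle.exp 0)) (f (Circle.exp 0)) :=
    { toContinuousMap := f.comp (Circle.exp.comp e)
      source' := by simp [e]
      target' := by simp [e] }
  have h1 : Path.Homotopic γ (Path.refl _) := SimplyConnectedSpace.paths_homotopic _ _
  obtain ⟨H⟩ := h1
  have h2 : (Circle.exp.comp e).HomotopicRel (ContinuousMap.const unitInterval (Circle.exp 0)) {0, 1} := by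
    have hgf' : ∀ z, g (f z) = z := fun z => DFunLike.congr_fun hgf z
    have h3 := ContinuousMap.HomotopicRel.comp_continuousMap ⟨H⟩ g
    convert h3 using 1
    · ext t; simp [γ, hgf']
    · ext t; simp [hgf']
  -- Lifts of paths homotopic relative to endpoints end at the same point, but here the ends are 2π
  -- and 0.
  have h4 := Circle.isCoveringMap_exp.liftPath_apply_one_eq_of_homotopicRel h2 0
    (by simp [e]) (by simp)
  have h5 : e = Circle.isCoveringMap_exp.liftPath (Circle.exp.comp e) 0 (by simp [e]) := by
    rw [IsCoveringMap.eq_liftPath_iff']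
    exact ⟨rfl, by simp [e]⟩
  have h6 : ContinuousMap.const unitInterval (0 : ℝ) = Circle.isCoveringMap_exp.liftPath
      (ContinuousMap.const unitInterval (Circle.exp 0)) 0 (by simp) := by
    rw [IsCoveringMap.eq_liftPath_iff']
    exact ⟨rfl, by simp⟩
  rw [← h5, ← h6] at h4
  simp [e, Real.pi_ne_zero] at h4

/-! ### The level complex and its ampleness -/

namespace AbstractSimplicialComplex

variable {ι : Type*}

/-- The complex on levelled vertices labelled by the vertices `ι × Bool` of a cross-polytope: a
face carries no antipodal labels, and among its subsets those strictly below one of its vertices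
`v` are prescribed by `c` at the level of `v`. -/
def levelComplex (c : ℕ → Set (Finset ((ι × Bool) × ℕ))) :
    AbstractSimplicialComplex ((ι × Bool) × ℕ) where
  faces := {σ | σ.Nonempty ∧ (∀ u ∈ σ, ∀ v ∈ σ, u.1.1 = v.1.1 → u.1.2 = v.1.2) ∧
    ∀ v ∈ σ, ∀ τ ⊆ σ, τ.Nonempty → (∀ u ∈ τ, u.2 < v.2) → τ ∈ c v.2}
  isRelLowerSet_faces := by
    rintro σ ⟨h0, h1, h2⟩
    exact ⟨h0, fun τ hτ hne => ⟨hne, fun u hu v hv => h1 u (hτ hu) v (hτ hv),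
      fun v hv ρ hρ => h2 v (hτ hv) ρ (hρ.trans hτ)⟩⟩
  singleton_mem v := by
    refine ⟨Finset.singleton_nonempty v, ?_, ?_⟩
    · intro u hu w hw _
      rw [Finset.mem_singleton.1 hu, Finset.mem_singleton.1 hw]
    · intro w hw τ hτ hne hlt
      obtain ⟨u, hu⟩ := hne
      have h := hlt u hu
      rw [Finset.mem_singleton.1 (hτ hu), Finset.mem_singleton.1 hw] at h
      exact absurd h (lt_irrefl _)

/-- If `c` prescribes every finite family of simplices at arbitrarily high levels, the level
complex is ample: a set of too few vertices misses a label, so that a vertex with the antipodal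
label can be joined to anything. -/
theorem isAmple_levelComplex [Fintype ι] [Nonempty ι] {c : ℕ → Set (Finset ((ι × Bool) × ℕ))}
    (hc : ∀ D : Set (Finset ((ι × Bool) × ℕ)), D.Finite → ∀ N, ∃ m, N < m ∧ c m = D)
    {r : ℕ} (hr : r < 2 * Fintype.card ι) : (levelComplex c).IsAmple r := by
  classical
  refine ⟨inferInstance, fun U hU L hL hLU => ?_⟩
  obtain ⟨p, hp⟩ : ∃ p : ι × Bool, p ∉ U.image Prod.fst := by
    by_contra! h
    have h1 : Fintype.card (ι × Bool) ≤ (U.image Prod.fst).card := by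
      rw [← Finset.card_univ]; exact Finset.card_le_card fun p _ => h p
    rw [Fintype.card_prod, Fintype.card_bool] at h1
    have := h1.trans Finset.card_image_le
    omega
  have hLU' : ∀ σ ∈ L.faces, σ ⊆ U := fun σ hσ u hu =>
    hLU u ((L.isRelLowerSet_faces hσ).2 (Finset.singleton_subset_iff.2 hu)
      (Finset.singleton_nonempty u))
  have hfin : L.faces.Finite :=
    U.powerset.finite_toSet.subset fun σ hσ => Finset.mem_coe.2 (Finset.mem_powerset.2 (hLU' σ hσ))
  obtain ⟨m, hm, hcm⟩ := hc L.faces hfin (U.sup Prod.snd)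
  have hlt : ∀ u ∈ U, u.2 < m := fun u hu => (Finset.le_sup (f := Prod.snd) hu).trans_lt hm
  refine ⟨((p.1, !p.2), m), fun σ => ⟨?_, fun hσ => ?_⟩⟩
  · rintro ⟨⟨hne, hv, -, -, h⟩, hσU⟩
    rw [← hcm]
    exact h _ (Finset.mem_cons_self _ _) σ (Finset.subset_cons hv) hne fun u hu => hlt u (hσU hu)
  · have hσU := hLU' σ hσ
    obtain ⟨hne, hK1, hK2⟩ := hL hσ
    have hv : ((p.1, !p.2), m) ∉ σ := fun h => lt_irrefl _ (hlt _ (hσU h))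
    have hlabel : ∀ u ∈ σ, u.1.1 = p.1 → u.1.2 = !p.2 := by
      intro u hu h1
      by_contra h2
      refine hp (Finset.mem_image.2 ⟨u, hσU hu, Prod.ext h1 ?_⟩)
      revert h2
      cases u.1.2 <;> cases p.2 <;> simp
    refine ⟨⟨hne, hv, Finset.cons_nonempty _, ?_, ?_⟩, hσU⟩
    · intro u hu w hw huw
      rcases Finset.mem_cons.1 hu with rfl | hu <;> rcases Finset.mem_cons.1 hw with rfl | hw
      · rfl
      · exact (hlabel w hw huw.symm).symm
      · exact hlabel u hu huw
      · exact hK1 u hu w hw huw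
    · intro w hw τ hτ hτne hτlt
      have hτσ : ((p.1, !p.2), m) ∉ τ → τ ⊆ σ := fun h =>
        fun u hu => (Finset.mem_cons.1 (hτ hu)).resolve_left fun e => h (e ▸ hu)
      rcases Finset.mem_cons.1 hw with rfl | hw
      · have := hτσ fun h => lt_irrefl _ (hτlt _ h)
        rw [hcm]
        exact (L.isRelLowerSet_faces hσ).2 this hτne
      -- The new vertex lies above `w`, so it cannot belong to `τ`: old constraints are unaffected.
      · refine hK2 w hw τ (hτσ fun h => ?_) hτne hτlt
        exact lt_asymm (hτlt _ h) (hlt w (hσU hw))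

/-- A sequence taking every finite family as a value infinitely often. -/
theorem exists_seq_finite_sets_frequently (α : Type*) [Countable α] :
    ∃ c : ℕ → Set α, ∀ D : Set α, D.Finite → ∀ N, ∃ m, N < m ∧ c m = D := by
  -- The extra factor ℕ makes every finite set occur infinitely often.
  obtain ⟨e, he⟩ := exists_surjective_nat (Finset α × ℕ)
  refine ⟨fun m => ((e m).1 : Set α), fun D hD N => ?_⟩
  have hinf : (e ⁻¹' Set.range fun k : ℕ => (hD.toFinset, k)).Infinite :=
    (Set.infinite_range_of_injective fun a b h => (Prod.ext_iff.1 h).2).preimage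
      (fun x _ => he x)
  obtain ⟨m, ⟨k, hk⟩, hm⟩ := hinf.exists_gt N
  exact ⟨m, hm, by simp [← hk]⟩

/-! ### The retraction of the realization onto the sphere -/

theorem continuous_simplexInclusion {V : Type*} (K : AbstractSimplicialComplex V) (s : K.faces) :
    Continuous (K.simplexInclusion s) :=
  continuous_iSup_rng (i := s) continuous_coinduced_rng

/-- A map out of the realization is continuous if it is so on every closed simplex. -/
theorem continuous_realization_iff {V Y : Type*} [TopologicalSpace Y]
    {K : AbstractSimplicialComplex V} {f : K.Realization → Y} :
    Continuous f ↔ ∀ s : K.faces, Continuous (f ∘ K.simplexInclusion s) := by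
  simp only [continuous_iSup_dom, continuous_coinduced_dom]

/-- The vertex of the cross-polytope with a given label. -/
noncomputable def crossVertex [DecidableEq ι] (p : ι × Bool) : EuclideanSpace ℝ ι :=
  EuclideanSpace.single p.1 (if p.2 then 1 else -1)

/-- The affine extension to the realization of the labelling by cross-polytope vertices. -/
noncomputable def labelMap [DecidableEq ι] (x : (ι × Bool) × ℕ → ℝ) : EuclideanSpace ℝ ι :=
  ∑ᶠ v, x v • crossVertex v.1

theorem labelMap_eq_sum [DecidableEq ι] {s : Finset ((ι × Bool) × ℕ)}
    {x : (ι × Bool) × ℕ → ℝ} (hx : x ∈ closedSimplex s) :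
    labelMap x = ∑ v ∈ s, x v • crossVertex v.1 := by
  refine finsum_eq_sum_of_support_subset _ fun v hv => ?_
  by_contra h
  exact hv (by simp [hx.2.1 v h])

/-- Without antipodal labels in a face, all contributions to one coordinate have the same sign, so a
vertex of non-zero weight cannot be cancelled. -/
theorem labelMap_ne_zero [DecidableEq ι] {c : ℕ → Set (Finset ((ι × Bool) × ℕ))}
    {s : Finset ((ι × Bool) × ℕ)} (hs : s ∈ (levelComplex c).faces) {x : (ι × Bool) × ℕ → ℝ}
    (hx : x ∈ closedSimplex s) : labelMap x ≠ 0 := by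
  intro h
  obtain ⟨w, hw, hxw⟩ : ∃ w ∈ s, x w ≠ 0 := by
    refine Finset.exists_ne_zero_of_sum_ne_zero ?_
    rw [hx.2.2]; exact one_ne_zero
  have hcoord : ∀ v ∈ s, (if w.1.2 then 1 else -1) * (x v • crossVertex v.1) w.1.1 =
      if v.1.1 = w.1.1 then x v else 0 := by
    intro v hv
    by_cases hvw : v.1.1 = w.1.1
    · have hb := hs.2.1 v hv w hw hvw
      cases hw2 : w.1.2 <;> simp [crossVertex, hvw, hb, hw2]
    · simp [crossVertex, hvw, Ne.symm hvw]
  have h0 : ∑ v ∈ s, (if v.1.1 = w.1.1 then x v else 0) = 0 := by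
    rw [← Finset.sum_congr rfl hcoord, ← Finset.mul_sum]
    have h1 : (labelMap x) w.1.1 = 0 := by rw [h]; rfl
    rw [labelMap_eq_sum hx] at h1
    have h2 : ∑ v ∈ s, (x v • crossVertex v.1) w.1.1 = 0 := by simpa using h1
    rw [h2, mul_zero]
  have h1 := (Finset.sum_eq_zero_iff_of_nonneg fun v _ => by
    split_ifs
    exacts [hx.1 v, le_rfl]).1 h0 w hw
  exact hxw (by simpa using h1)

/-- The radial projection of the realization of a level complex to the sphere. -/
noncomputable def toSphere [DecidableEq ι] [Fintype ι] (c : ℕ → Set (Finset ((ι × Bool) × ℕ))) :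
    C((levelComplex c).Realization, Metric.sphere (0 : EuclideanSpace ℝ ι) 1) where
  toFun x := ⟨‖labelMap x.1‖⁻¹ • labelMap x.1, by
    obtain ⟨s, hs, hx⟩ := x.2
    simp [norm_smul, inv_mul_cancel₀ (norm_ne_zero_iff.2 (labelMap_ne_zero hs hx))]⟩
  continuous_toFun := by
    refine Continuous.subtype_mk ?_ _
    rw [continuous_realization_iff]
    intro s
    have h : Continuous fun x : closedSimplex (s : Finset ((ι × Bool) × ℕ)) => labelMap x.1 := by
      simp_rw [fun x : closedSimplex (s : Finset ((ι × Bool) × ℕ)) => labelMap_eq_sum x.2]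
      exact continuous_finsetSum _ fun v _ =>
        ((continuous_apply v).comp continuous_subtype_val).smul continuous_const
    exact (h.norm.inv₀ fun x => norm_ne_zero_iff.2 (labelMap_ne_zero s.2 x.2)).smul h

/-- Normalized barycentric coordinates of a point in the cross-polytope at level `0`. -/
noncomputable def crossCoord [Fintype ι] (x : EuclideanSpace ℝ ι) (v : (ι × Bool) × ℕ) : ℝ :=
  if v.2 = 0 then max (if v.1.2 then x v.1.1 else -x v.1.1) 0 / ∑ i, |x i| else 0

theorem injective_crossFacet_vertex (ε : ι → Bool) :
    Function.Injective fun i => (((i, ε i), 0) : (ι × Bool) × ℕ) :=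
  fun _ _ h => congrArg (fun v => v.1.1) h

/-- The facet of the cross-polytope with given signs. -/
def crossFacet [Fintype ι] (ε : ι → Bool) : Finset ((ι × Bool) × ℕ) :=
  Finset.univ.map ⟨_, injective_crossFacet_vertex ε⟩

/-- Nothing lies below level 0, so the condition involving `c` is vacuous. -/
theorem crossFacet_mem_faces [Fintype ι] [Nonempty ι] (c : ℕ → Set (Finset ((ι × Bool) × ℕ)))
    (ε : ι → Bool) : crossFacet ε ∈ (levelComplex c).faces := by
  have hmem : ∀ v ∈ crossFacet ε, v = ((v.1.1, ε v.1.1), 0) := by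
    intro v hv
    obtain ⟨i, -, rfl⟩ := Finset.mem_map.1 hv
    rfl
  refine ⟨by simp [crossFacet], fun u hu v hv h => ?_, fun v hv τ _ hne hlt => ?_⟩
  · rw [hmem u hu, hmem v hv]
    exact congrArg ε h
  · obtain ⟨u, hu⟩ := hne
    have := hlt u hu
    rw [hmem v hv] at this
    exact absurd this (Nat.not_lt_zero _)

/-- The closed orthant with given signs. -/
def signOrthant (ι : Type*) [Fintype ι] (ε : ι → Bool) : Set (EuclideanSpace ℝ ι) :=
  {x | ∀ i, 0 ≤ if ε i then x i else -x i}

theorem isClosed_signOrthant [Fintype ι] (ε : ι → Bool) : IsClosed (signOrthant ι ε) := by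
  simp only [signOrthant, Set.ofPred_forall]
  refine isClosed_iInter fun i => isClosed_le continuous_const ?_
  split_ifs <;> fun_prop

theorem exists_mem_signOrthant [Fintype ι] (x : EuclideanSpace ℝ ι) :
    ∃ ε, x ∈ signOrthant ι ε := by
  refine ⟨fun i => decide (0 ≤ x i), fun i => ?_⟩
  by_cases h : 0 ≤ x i
  · simp [h]
  · simpa [h] using (not_le.1 h).le

theorem sum_abs_pos_of_ne_zero [Fintype ι] {x : EuclideanSpace ℝ ι} (hx : x ≠ 0) :
    0 < ∑ i, |x i| := by
  obtain ⟨i, hi⟩ : ∃ i, x i ≠ 0 := by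
    by_contra! h
    exact hx (by ext i; exact h i)
  exact Finset.sum_pos' (fun i _ => abs_nonneg _) ⟨i, Finset.mem_univ i, abs_pos.2 hi⟩

theorem crossCoord_of_mem_signOrthant [Fintype ι] {ε : ι → Bool} {x : EuclideanSpace ℝ ι}
    (hx : x ∈ signOrthant ι ε) (i : ι) :
    crossCoord x ((i, ε i), 0) = |x i| / ∑ i, |x i| := by
  have h := hx i
  rw [crossCoord]
  cases hε : ε i <;> simp_all [abs_of_nonneg, abs_of_nonpos]

theorem crossCoord_mem_closedSimplex [Fintype ι] {ε : ι → Bool} {x : EuclideanSpace ℝ ι}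
    (hx : x ∈ signOrthant ι ε) (hx0 : x ≠ 0) : crossCoord x ∈ closedSimplex (crossFacet ε) := by
  have hpos := sum_abs_pos_of_ne_zero hx0
  refine ⟨fun v => ?_, ?_, ?_⟩
  · rw [crossCoord]
    split_ifs <;> positivity
  · rintro ⟨⟨i, b⟩, m⟩ hv
    by_cases hm : m = 0
    · subst hm
      have hb : b ≠ ε i := by
        rintro rfl
        exact hv (Finset.mem_map_of_mem _ (Finset.mem_univ i))
      have h := hx i
      rw [crossCoord]
      cases hε : ε i <;> cases b <;> simp_all
    · simp [crossCoord, hm]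
  · rw [crossFacet, Finset.sum_map]
    simp only [Function.Embedding.coeFn_mk, crossCoord_of_mem_signOrthant hx]
    rw [← Finset.sum_div, div_self hpos.ne']

/-- The inclusion of the sphere, as the cross-polytope at level `0`. -/
noncomputable def ofSphereFun [Fintype ι] [Nonempty ι] (c : ℕ → Set (Finset ((ι × Bool) × ℕ)))
    (x : Metric.sphere (0 : EuclideanSpace ℝ ι) 1) : (levelComplex c).Realization :=
  ⟨crossCoord x.1, by
    obtain ⟨ε, hε⟩ := exists_mem_signOrthant x.1
    exact ⟨_, crossFacet_mem_faces c ε,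
      crossCoord_mem_closedSimplex hε (Metric.ne_of_mem_sphere x.2 one_ne_zero)⟩⟩

/-- Finitely many closed orthants cover the sphere, and over each the map factors through a single
closed simplex, so continuity there is coordinatewise. -/
theorem continuous_ofSphereFun [Fintype ι] [Nonempty ι]
    (c : ℕ → Set (Finset ((ι × Bool) × ℕ))) : Continuous (ofSphereFun c) := by
  classical
  let S : (ι → Bool) → Set (Metric.sphere (0 : EuclideanSpace ℝ ι) 1) :=
    fun ε => Subtype.val ⁻¹' signOrthant ι ε
  refine LocallyFinite.continuous (f := S) (locallyFinite_of_finite _)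
    (Set.eq_univ_of_forall fun x => Set.mem_iUnion.2 (exists_mem_signOrthant x.1))
    (fun ε => (isClosed_signOrthant ε).preimage continuous_subtype_val) fun ε => ?_
  have hne : ∀ x : Metric.sphere (0 : EuclideanSpace ℝ ι) 1, x.1 ≠ 0 := fun x =>
    Metric.ne_of_mem_sphere x.2 one_ne_zero
  rw [continuousOn_iff_continuous_domRestrict]
  let q : S ε → closedSimplex (crossFacet ε) :=
    fun x => ⟨crossCoord x.1.1, crossCoord_mem_closedSimplex x.2 (hne x.1)⟩
  have hq : Continuous q := by
    refine Continuous.subtype_mk (continuous_pi fun v => ?_) _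
    have hsum : Continuous fun x : S ε => ∑ i, |x.1.1 i| := by fun_prop
    have hcoord : Continuous fun x : S ε => x.1.1 v.1.1 := by fun_prop
    have hpos : ∀ x : S ε, ∑ i, |x.1.1 i| ≠ 0 := fun x => (sum_abs_pos_of_ne_zero (hne x.1)).ne'
    simp only [crossCoord]
    split_ifs
    · exact (hcoord.max continuous_const).div hsum hpos
    · exact (hcoord.neg.max continuous_const).div hsum hpos
    · exact continuous_const
  exact ((levelComplex c).continuous_simplexInclusion ⟨_, crossFacet_mem_faces c ε⟩).comp hq

/-- The affine extension sends the barycentric coordinates of `x` to `x` divided by its ℓ¹ norm,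
which radial projection undoes. -/
theorem toSphere_ofSphereFun [DecidableEq ι] [Fintype ι] [Nonempty ι]
    (c : ℕ → Set (Finset ((ι × Bool) × ℕ))) (x : Metric.sphere (0 : EuclideanSpace ℝ ι) 1) :
    toSphere c (ofSphereFun c x) = x := by
  obtain ⟨ε, hε⟩ := exists_mem_signOrthant x.1
  have hne : x.1 ≠ 0 := Metric.ne_of_mem_sphere x.2 one_ne_zero
  have hpos := sum_abs_pos_of_ne_zero hne
  have h : labelMap (crossCoord x.1) = (∑ i, |x.1 i|)⁻¹ • x.1 := by
    have h1 : ∀ i, crossCoord x.1 ((i, ε i), 0) • crossVertex (i, ε i) =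
        EuclideanSpace.single i ((∑ i, |x.1 i|)⁻¹ * x.1 i) := by
      intro i
      have hi := hε i
      rw [crossCoord_of_mem_signOrthant hε, crossVertex]
      ext j
      cases hεi : ε i <;> simp_all [abs_of_nonneg, abs_of_nonpos, div_eq_inv_mul]
      split_ifs <;> simp
    rw [labelMap_eq_sum (crossCoord_mem_closedSimplex hε hne), crossFacet, Finset.sum_map]
    refine (Finset.sum_congr rfl fun i _ => h1 i).trans ?_
    ext j
    simp [Pi.single_apply]
  apply Subtype.ext
  change ‖labelMap (crossCoord x.1)‖⁻¹ • labelMap (crossCoord x.1) = x.1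
  have hx1 : ‖x.1‖ = 1 := by simp
  rw [h, norm_smul, hx1, mul_one, norm_inv, Real.norm_of_nonneg hpos.le, inv_inv, smul_smul,
    mul_inv_cancel₀ hpos.ne', one_smul]

end AbstractSimplicialComplex

/-! ### Conclusion -/

/-- The circle is homeomorphic to the unit sphere of the Euclidean plane. -/
noncomputable def circleHomeomorphSphere :
    Circle ≃ₜ Metric.sphere (0 : EuclideanSpace ℝ (Fin 2)) 1 where
  toFun z := ⟨Complex.orthonormalBasisOneI.repr z, by
    rw [mem_sphere_zero_iff_norm, LinearIsometryEquiv.norm_map]; exact z.norm_coe⟩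
  invFun x := ⟨Complex.orthonormalBasisOneI.repr.symm x.1, mem_sphere_zero_iff_norm.2 <| by
    rw [LinearIsometryEquiv.norm_map]; exact mem_sphere_zero_iff_norm.1 x.2⟩
  left_inv z := Subtype.ext (LinearIsometryEquiv.symm_apply_apply _ _)
  right_inv x := Subtype.ext (LinearIsometryEquiv.apply_symm_apply _ _)
  continuous_toFun := continuous_induced_rng.2
    (Complex.orthonormalBasisOneI.repr.continuous.comp continuous_subtype_val)
  continuous_invFun := continuous_induced_rng.2
    (Complex.orthonormalBasisOneI.repr.symm.continuous.comp continuous_subtype_val)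

open AbstractSimplicialComplex in
theorem theorem2p1 :
    (∀ n : ℕ, ∃ (V : Type) (K : AbstractSimplicialComplex V),
      Infinite V ∧ K.IsAmple (2 * n + 1) ∧ ¬ IsNConnected n K.Realization) ∧
    (∃ (V : Type) (K : AbstractSimplicialComplex V),
      K.IsAmple 3 ∧ ¬ SimplyConnectedSpace K.Realization) := by
  constructor
  · intro n
    obtain ⟨c, hc⟩ := exists_seq_finite_sets_frequently (Finset ((Fin (n + 1) × Bool) × ℕ))
    refine ⟨_, levelComplex c, inferInstance, isAmple_levelComplex hc (by simp; omega), ?_⟩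
    rintro ⟨-, h⟩
    refine not_nullhomotopic_id_sphere (EuclideanSpace ℝ (Fin (n + 1))) ?_
    have h1 := (h n le_rfl ⟨_, continuous_ofSphereFun c⟩).comp_right (toSphere c)
    have h2 : (toSphere c).comp ⟨_, continuous_ofSphereFun c⟩ = ContinuousMap.id _ :=
      ContinuousMap.ext fun x => toSphere_ofSphereFun c x
    rwa [h2] at h1
  · obtain ⟨c, hc⟩ := exists_seq_finite_sets_frequently (Finset ((Fin 2 × Bool) × ℕ))
    refine ⟨_, levelComplex c, isAmple_levelComplex hc (by simp), ?_⟩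
    refine not_simplyConnectedSpace_of_circle_retract
      ((⟨_, continuous_ofSphereFun c⟩ : C(_, _)).comp circleHomeomorphSphere)
      ((circleHomeomorphSphere.symm : C(_, _)).comp (toSphere c)) ?_
    refine ContinuousMap.ext fun z => ?_
    change circleHomeomorphSphere.symm (toSphere c (ofSphereFun c (circleHomeomorphSphere z))) = z
    rw [toSphere_ofSphereFun, Homeomorph.symm_apply_apply]
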